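/- Let $H_0=\{\langle x,y\rangle\in\mathbb R^2 : x>0\}$. The (separable) Prüfer surface $\mathsf P$ is the set obtained from $H_0$ by adjoining, for each $c\in\mathbb R$, a copy $\mathbb R_c$ of $\mathbb R$, with the following topology (for $E\subset\mathbb R$, $E_c$ denotes the copy of $E$ in $\mathbb R_c$): points of $H_0$ have their usual Euclidean neighborhoods, and a neighborhood basis of the point of $\mathbb R_c$ corresponding to $u\in\mathbb R$ is given by the sets $$T^c_{a,b,\epsilon}=(a,b)_c\cup\{\langle x,y\rangle\in H_0 : ax+c<y<bx+c,\ x<\epsilon\},\qquad a<u<b,\ \epsilon>0.$$ Let $0_c$ be the $0$-point of $\mathbb R_c$ and $Z=\{0_c : c\in\mathbb R\}$. By a surface with boundary we mean a connected Hausdorff space that is locally homeomorphic to the closed half plane (each point has an open neighborhood homeomorphic to an open subset of it); no countability condition is imposed. **Theorem 1.7.** The Prüfer surface $\mathsf P$ is a separable contractible surface with boundary. The set $Z$ is closed in $\mathsf P$, and the open subspace $\mathsf P-Z$ is a separable, non-metrizable surface with boundary that has trivial homotopy groups (that is, $\pi_n(\mathsf P-Z,x)$ is trivial for every $n\ge 0$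 and every base point $x$, the case $n=0$ meaning path connectedness) but is not contractible; moreover $\mathsf P-Z$ is not homotopy equivalent to any CW-complex. -/

import Mathlib

/-- The open half plane `{⟨x, y⟩ ∈ ℝ² | 0 < x}`. -/
abbrev OpenHalfPlane : Type := {q : ℝ × ℝ // 0 < q.1}

/-- The underlying set of the (separable) Prüfer surface: the open half plane together with one
copy `ℝ_c` of the real line for every height `c`. -/
inductive PruferSurface : Type
  | inner (q : OpenHalfPlane) : PruferSurface
  | boundary (c u : ℝ) : PruferSurface

namespace PruferSurface

/-- The set `(a, b)_c ∪ {⟨x, y⟩ | 0 < x < ε, a x + c < y < b x + c}`. -/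
def sector (c a b ε : ℝ) : Set PruferSurface :=
  boundary c '' Set.Ioo a b ∪
    inner '' {q | a * q.1.1 + c < q.1.2 ∧ q.1.2 < b * q.1.1 + c ∧ q.1.1 < ε}

/-- The points of the open half plane keep their Euclidean neighbourhoods, and the sets
`sector c a b ε` with `a < u < b` and `0 < ε` form a neighbourhood basis of the point `u`
of `ℝ_c`. -/
instance : TopologicalSpace PruferSurface where
  IsOpen U := IsOpen (inner ⁻¹' U) ∧ ∀ c u, boundary c u ∈ U →
    ∃ a b ε, a < u ∧ u < b ∧ 0 < ε ∧ sector c a b ε ⊆ U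
  isOpen_univ := ⟨by simp, fun _ u _ =>
    ⟨u - 1, u + 1, 1, by linarith, by linarith, one_pos, Set.subset_univ _⟩⟩
  isOpen_inter := by
    rintro s t ⟨hs, hs'⟩ ⟨ht, ht'⟩
    refine ⟨hs.inter ht, fun c u hu => ?_⟩
    obtain ⟨a, b, e, ha, hb, he, h⟩ := hs' c u hu.1
    obtain ⟨a', b', e', ha', hb', he', h'⟩ := ht' c u hu.2
    refine ⟨max a a', min b b', min e e', max_lt ha ha', lt_min hb hb', lt_min he he', ?_⟩
    rintro _ (⟨v, ⟨h1, h2⟩, rfl⟩ | ⟨q, ⟨h1, h2, h3⟩, rfl⟩)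
    · rw [max_lt_iff] at h1
      rw [lt_min_iff] at h2
      exact ⟨h (Or.inl ⟨v, ⟨h1.1, h2.1⟩, rfl⟩), h' (Or.inl ⟨v, ⟨h1.2, h2.2⟩, rfl⟩)⟩
    · have hq : 0 ≤ q.1.1 := q.2.le
      rw [lt_min_iff] at h3
      have k1 := mul_le_mul_of_nonneg_right (le_max_left a a') hq
      have k2 := mul_le_mul_of_nonneg_right (le_max_right a a') hq
      have k3 := mul_le_mul_of_nonneg_right (min_le_left b b') hq
      have k4 := mul_le_mul_of_nonneg_right (min_le_right b b') hq
      exact ⟨h (Or.inr ⟨q, ⟨by linarith, by linarith, h3.1⟩, rfl⟩),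
        h' (Or.inr ⟨q, ⟨by linarith, by linarith, h3.2⟩, rfl⟩)⟩
  isOpen_sUnion := by
    intro S hS
    refine ⟨?_, ?_⟩
    · rw [Set.preimage_sUnion]
      exact isOpen_biUnion fun t ht => (hS t ht).1
    · rintro c u ⟨t, ht, hu⟩
      obtain ⟨a, b, e, ha, hb, he, h⟩ := (hS t ht).2 c u hu
      exact ⟨a, b, e, ha, hb, he, h.trans (Set.subset_sUnion_of_mem ht)⟩

/-- The set of the `0`-points of all the boundary components `ℝ_c`. -/
def zeroPoints : Set PruferSurface := Set.range fun c : ℝ => boundary c 0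

end PruferSurface

/-- A surface with (possibly empty) boundary: a connected Hausdorff space locally homeomorphic to
the closed Euclidean half plane. No countability or metrizability is required. -/
structure IsSurfaceWithBoundary (X : Type*) [TopologicalSpace X] : Prop where
  t2 : T2Space X
  connected : ConnectedSpace X
  charts : Nonempty (ChartedSpace (EuclideanHalfSpace 2) X)

open Set Filter Topology unitInterval

/-! Everything is read in the polar charts: abscissa `x` and slope `u` at `⟨0, c⟩` embed the closed
half plane onto an open set containing all of `H_0` and the single boundary component `ℝ_c`. The
blow-down to the closed half plane, which sends `ℝ_c` to `⟨0, c⟩`, provides the heights used below.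

The whole surface is contracted by maps preserving ordinates, of the form `(x, u) ↦ (g x, u * r x)`
in every polar chart at once; this requires `g x * r x = x`. Leaving the boundary means `g 0 > 0`,
hence `r 0 = 0`, so the slopes on each `ℝ_c` are first collapsed onto `0_c`, and only then is the
surface moved into the convex `H_0`. The first stage is exactly what deleting `Z` forbids.

A compact set still meets only finitely many `ℝ_c`, and those can be pushed into `H_0` along the
lines through `⟨0, c⟩`. Two maps of a cube that agree on its boundary can thus be made to take
values in `H_0` off that boundary, and are then joined by segments; so all homotopy groups vanish.

Non-contractibility is a rigidity statement: if `k` is homotopic to the identity of the complement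
of `Z`, then `k` maps `1_c` into `ℝ_c` for all but countably many `c`
(`countable_setOf_notMem_boundaryLine`). At a fixed time, the rays of slope `1` at `c` and slope
`-1` at a nearby `d > c` cross, so only countably many `c` can misbehave; a countable dense set of
times and the connectedness of the interval extend this to the whole homotopy. A Lindelöf set meets
only countably many `ℝ_c`, so `k` cannot have values in one. This excludes constants, and also maps
factoring through a CW complex, where a separable space has its image in a countable subcomplex. -/

/-- The closed half plane, used as the domain of the polar charts of the Prüfer surface. -/
abbrev ClosedHalfPlane : Type := {p : ℝ × ℝ // 0 ≤ p.1}

namespace PruferSurface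

/-! ### Sectors as neighbourhoods -/

theorem isOpen_iff {U : Set PruferSurface} :
    IsOpen U ↔ IsOpen (inner ⁻¹' U) ∧ ∀ c u, boundary c u ∈ U →
      ∃ a b ε, a < u ∧ u < b ∧ 0 < ε ∧ sector c a b ε ⊆ U := Iff.rfl

theorem continuous_inner : Continuous inner :=
  continuous_def.2 fun _ hU => hU.1

theorem inner_injective : Function.Injective inner := fun _ _ h => by
  injection h

theorem isOpenEmbedding_inner : IsOpenEmbedding inner := by
  refine .of_continuous_injective_isOpenMap continuous_inner inner_injective fun V hV => ?_
  refine ⟨by rwa [preimage_image_eq _ inner_injective], ?_⟩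
  rintro c u ⟨q, -, h⟩
  cases h

@[simp]
theorem boundary_mem_sector {c a b ε d u : ℝ} :
    boundary d u ∈ sector c a b ε ↔ d = c ∧ a < u ∧ u < b := by
  simp only [sector, mem_union, mem_image, boundary.injEq, reduceCtorEq, and_false, exists_false,
    or_false, mem_Ioo]
  constructor
  · rintro ⟨v, hv, rfl, rfl⟩
    exact ⟨rfl, hv⟩
  · rintro ⟨rfl, hv⟩
    exact ⟨u, hv, rfl, rfl⟩

@[simp]
theorem inner_mem_sector {c a b ε : ℝ} {q : OpenHalfPlane} :
    inner q ∈ sector c a b ε ↔ a * q.1.1 + c < q.1.2 ∧ q.1.2 < b * q.1.1 + c ∧ q.1.1 < ε := by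
  simp only [sector, mem_union, mem_image, reduceCtorEq, and_false, exists_false, false_or]
  constructor
  · rintro ⟨p, hp, h⟩
    cases h
    exact hp
  · exact fun h => ⟨q, h, rfl⟩

theorem isOpen_sector {c a b ε : ℝ} (hε : 0 < ε) : IsOpen (sector c a b ε) := by
  refine isOpen_iff.2 ⟨?_, fun d u hu => ?_⟩
  · have : inner ⁻¹' sector c a b ε =
        {q | a * q.1.1 + c < q.1.2 ∧ q.1.2 < b * q.1.1 + c ∧ q.1.1 < ε} := by
      ext q
      simp
    rw [this]
    simp only [ofPred_and]
    refine IsOpen.inter ?_ (IsOpen.inter ?_ ?_) <;> exact isOpen_lt (by fun_prop) (by fun_prop)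
  · obtain ⟨rfl, ha, hb⟩ := boundary_mem_sector.1 hu
    exact ⟨a, b, ε, ha, hb, hε, subset_rfl⟩

theorem mem_nhds_boundary {c u : ℝ} {U : Set PruferSurface} :
    U ∈ 𝓝 (boundary c u) ↔ ∃ a b ε, a < u ∧ u < b ∧ 0 < ε ∧ sector c a b ε ⊆ U := by
  constructor
  · intro h
    obtain ⟨V, hVU, hV, hm⟩ := mem_nhds_iff.1 h
    obtain ⟨a, b, ε, ha, hb, hε, hs⟩ := hV.2 c u hm
    exact ⟨a, b, ε, ha, hb, hε, hs.trans hVU⟩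
  · rintro ⟨a, b, ε, ha, hb, hε, hs⟩
    exact mem_of_superset ((isOpen_sector hε).mem_nhds (by simp [ha, hb])) hs

/-! ### Polar charts -/

/-- Coordinates around the boundary component `ℝ_c`: the abscissa and the slope of the segment
from `⟨0, c⟩`. -/
noncomputable def polar (c : ℝ) (p : ℝ × ℝ) : PruferSurface :=
  if h : 0 < p.1 then inner ⟨(p.1, p.2 * p.1 + c), h⟩ else boundary c p.2

theorem polar_of_pos {c : ℝ} {p : ℝ × ℝ} (h : 0 < p.1) :
    polar c p = inner ⟨(p.1, p.2 * p.1 + c), h⟩ := dif_pos h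

theorem polar_of_le {c : ℝ} {p : ℝ × ℝ} (h : p.1 ≤ 0) : polar c p = boundary c p.2 :=
  dif_neg h.not_gt

@[simp]
theorem polar_zero (c u : ℝ) : polar c (0, u) = boundary c u := polar_of_le le_rfl

theorem polar_slope (c : ℝ) (q : OpenHalfPlane) :
    polar c (q.1.1, (q.1.2 - c) / q.1.1) = inner q := by
  rw [polar_of_pos (show 0 < (q.1.1, (q.1.2 - c) / q.1.1).1 from q.2)]
  congr 1
  ext
  · rfl
  · have := q.2.ne'
    simp only
    field_simp
    ring

theorem polar_mem_sector {c a b ε : ℝ} {p : ℝ × ℝ} (hp : 0 ≤ p.1) (h1 : p.1 < ε) (h2 : a < p.2)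
    (h3 : p.2 < b) : polar c p ∈ sector c a b ε := by
  rcases hp.eq_or_lt with h | h
  · rw [polar_of_le h.ge]
    simp [h2, h3]
  · rw [polar_of_pos h]
    simp only [inner_mem_sector]
    exact ⟨by nlinarith, by nlinarith, h1⟩

theorem continuous_polar (c : ℝ) : Continuous fun p : ClosedHalfPlane => polar c p := by
  rw [continuous_iff_continuousAt]
  intro p
  rcases p.2.eq_or_lt with h | h
  · rw [ContinuousAt, polar_of_le h.ge]
    intro U hU
    rw [mem_map]
    obtain ⟨a, b, ε, ha, hb, hε, hs⟩ := mem_nhds_boundary.1 hU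
    have k1 : ∀ᶠ q : ClosedHalfPlane in 𝓝 p, q.1.1 < ε :=
      ContinuousAt.eventually_lt (by fun_prop) (by fun_prop) (by rwa [← h])
    have k2 : ∀ᶠ q : ClosedHalfPlane in 𝓝 p, a < q.1.2 :=
      ContinuousAt.eventually_lt (by fun_prop) (by fun_prop) ha
    have k3 : ∀ᶠ q : ClosedHalfPlane in 𝓝 p, q.1.2 < b :=
      ContinuousAt.eventually_lt (by fun_prop) (by fun_prop) hb
    filter_upwards [k1, k2, k3] with q h1 h2 h3
    exact hs (polar_mem_sector q.2 h1 h2 h3)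
  · have hopen : IsOpen {q : ClosedHalfPlane | 0 < q.1.1} :=
      isOpen_lt (by fun_prop) (by fun_prop)
    refine ContinuousOn.continuousAt (s := {q : ClosedHalfPlane | 0 < q.1.1}) ?_
      (hopen.mem_nhds h)
    rw [continuousOn_iff_continuous_domRestrict]
    have : Continuous fun q : {q : ClosedHalfPlane | 0 < q.1.1} =>
        inner ⟨(q.1.1.1, q.1.1.2 * q.1.1.1 + c), q.2⟩ :=
      continuous_inner.comp (Continuous.subtype_mk (by fun_prop) _)
    refine this.congr fun q => ?_
    exact (polar_of_pos (p := q.1.1) q.2).symm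

theorem continuousOn_polar (c : ℝ) : ContinuousOn (polar c) {p | 0 ≤ p.1} :=
  continuousOn_iff_continuous_domRestrict.2 (continuous_polar c)

theorem polar_injective (c : ℝ) : Function.Injective fun p : ClosedHalfPlane => polar c p := by
  rintro ⟨p, hp⟩ ⟨q, hq⟩ h
  simp only at h hp hq
  rcases hp.eq_or_lt with hp' | hp' <;> rcases hq.eq_or_lt with hq' | hq'
  · rw [polar_of_le hp'.ge, polar_of_le hq'.ge] at h
    injection h with _ h
    exact Subtype.ext (Prod.ext (hp'.symm.trans hq') h)
  · rw [polar_of_le hp'.ge, polar_of_pos hq'] at h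
    cases h
  · rw [polar_of_le hq'.ge, polar_of_pos hp'] at h
    cases h
  · rw [polar_of_pos hp', polar_of_pos hq'] at h
    have h' := congrArg Subtype.val (inner_injective h)
    simp only [Prod.mk.injEq] at h'
    obtain ⟨h1, h2⟩ := h'
    rw [h1] at h2
    exact Subtype.ext (Prod.ext h1 (mul_right_cancel₀ hq'.ne' (add_right_cancel h2)))

theorem isOpenEmbedding_polar (c : ℝ) :
    IsOpenEmbedding fun p : ClosedHalfPlane => polar c p := by
  refine .of_continuous_injective_isOpenMap (continuous_polar c) (polar_injective c)
    fun V hV => ?_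
  refine isOpen_iff.2 ⟨?_, ?_⟩
  · let f : OpenHalfPlane → ClosedHalfPlane := fun q => ⟨(q.1.1, (q.1.2 - c) / q.1.1), q.2.le⟩
    have hf : Continuous f := by
      refine Continuous.subtype_mk (Continuous.prodMk (by fun_prop) ?_) _
      exact Continuous.div (by fun_prop) (by fun_prop) fun q => q.2.ne'
    have : inner ⁻¹' ((fun p : ClosedHalfPlane => polar c p) '' V) = f ⁻¹' V := by
      ext q
      have hq : polar c (f q).1 = inner q := polar_slope c q
      rw [mem_preimage, mem_preimage, ← hq]
      exact (polar_injective c).mem_set_image (s := V)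
    rw [this]
    exact hV.preimage hf
  · rintro d u ⟨p, hpV, hp⟩
    simp only at hp
    rcases p.2.eq_or_lt with h | h
    · rw [show polar c p = boundary c p.1.2 from polar_of_le h.ge] at hp
      injection hp with hc hu
      subst hc hu
      obtain ⟨W, hW, rfl⟩ := isOpen_induced_iff.1 hV
      obtain ⟨ε, hε, hs⟩ := Metric.isOpen_iff.1 hW p.1 hpV
      -- The plane carries the sup metric, so the `ε`-ball is a box, and a box at the edge is a
      -- sector in polar coordinates.
      refine ⟨p.1.2 - ε, p.1.2 + ε, ε, by linarith, by linarith, hε, ?_⟩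
      have key : ∀ q : ClosedHalfPlane, q.1.1 < ε → p.1.2 - ε < q.1.2 → q.1.2 < p.1.2 + ε →
          q.1 ∈ W := by
        intro q h1 h2 h3
        refine hs ?_
        rw [Metric.mem_ball, Prod.dist_eq, max_lt_iff, Real.dist_eq, Real.dist_eq, ← h, abs_lt,
          abs_lt]
        have := q.2
        exact ⟨⟨by linarith, by linarith⟩, by linarith, by linarith⟩
      rintro (q | ⟨d, v⟩) hq
      · rw [inner_mem_sector] at hq
        have hq0 : 0 < q.1.1 := q.2
        refine ⟨⟨(q.1.1, (q.1.2 - c) / q.1.1), q.2.le⟩, key _ hq.2.2 ?_ ?_, polar_slope c q⟩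
        · simp only
          rw [lt_div_iff₀ hq0]
          linarith
        · simp only
          rw [div_lt_iff₀ hq0]
          linarith
      · rw [boundary_mem_sector] at hq
        obtain ⟨rfl, h1, h2⟩ := hq
        exact ⟨⟨(0, v), le_rfl⟩, key _ hε h1 h2, polar_zero _ _⟩
    · rw [show polar c p = _ from polar_of_pos h] at hp
      cases hp

theorem exists_polar (p : PruferSurface) : ∃ c, ∃ q : ClosedHalfPlane, polar c q = p := by
  rcases p with q | ⟨c, u⟩
  · exact ⟨0, ⟨(q.1.1, (q.1.2 - 0) / q.1.1), q.2.le⟩, polar_slope 0 q⟩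
  · exact ⟨c, ⟨(0, u), le_rfl⟩, polar_zero c u⟩

theorem continuousAt_of_polar {T Y : Type*} [TopologicalSpace T] [TopologicalSpace Y]
    {F : PruferSurface × T → Y} {c : ℝ} {p : ClosedHalfPlane} {t : T}
    (h : ContinuousAt (fun q : ClosedHalfPlane × T => F (polar c q.1, q.2)) (p, t)) :
    ContinuousAt F (polar c p, t) :=
  (((isOpenEmbedding_polar c).prodMap IsOpenEmbedding.id).continuousAt_iff
    (g := F) (x := (p, t))).1 h

/-- The polar charts cover the surface, and an open embedding stays one after multiplication by the
parameter space; this is how homotopies are checked for continuity. -/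
theorem continuous_of_polar {T Y : Type*} [TopologicalSpace T] [TopologicalSpace Y]
    {F : PruferSurface × T → Y}
    (h : ∀ c, Continuous fun q : ClosedHalfPlane × T => F (polar c q.1, q.2)) :
    Continuous F := by
  rw [continuous_iff_continuousAt]
  rintro ⟨p, t⟩
  obtain ⟨c, q, rfl⟩ := exists_polar p
  exact continuousAt_of_polar (h c).continuousAt

theorem isOpen_range_polar (c : ℝ) : IsOpen (range fun p : ClosedHalfPlane => polar c p) :=
  (isOpenEmbedding_polar c).isOpen_range

/-- Each polar chart meets only one boundary component; all the countability arguments about the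
components `ℝ_c` start here. -/
theorem eq_of_boundary_mem_range_polar {c d u : ℝ}
    (h : boundary d u ∈ range fun p : ClosedHalfPlane => polar c p) : d = c := by
  obtain ⟨p, hp⟩ := h
  simp only at hp
  rcases p.2.eq_or_lt with h | h
  · rw [show polar c p = boundary c p.1.2 from polar_of_le h.ge] at hp
    injection hp with hc
    exact hc.symm
  · rw [show polar c p = _ from polar_of_pos h] at hp
    cases hp

/-! ### Blow-down, density of the open half plane, Hausdorff property -/

/-- The blow-down of the Prüfer surface onto the closed half plane. -/
def blowDown : PruferSurface → ℝ × ℝ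
  | inner q => q.1
  | boundary c _ => (0, c)

@[simp] theorem blowDown_inner (q : OpenHalfPlane) : blowDown (inner q) = q.1 := rfl

@[simp] theorem blowDown_boundary (c u : ℝ) : blowDown (boundary c u) = (0, c) := rfl

theorem blowDown_polar {c : ℝ} {p : ℝ × ℝ} (hp : 0 ≤ p.1) :
    blowDown (polar c p) = (p.1, p.2 * p.1 + c) := by
  rcases hp.eq_or_lt with h | h
  · rw [polar_of_le h.ge, blowDown_boundary, ← h]
    simp
  · rw [polar_of_pos h, blowDown_inner]

theorem continuous_blowDown : Continuous blowDown := by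
  have : Continuous fun p : PruferSurface × Unit => blowDown p.1 := by
    refine continuous_of_polar fun c => ?_
    have : Continuous fun q : ClosedHalfPlane × Unit => (q.1.1.1, q.1.1.2 * q.1.1.1 + c) := by
      fun_prop
    exact this.congr fun q => (blowDown_polar q.1.2).symm
  exact this.comp (g := fun p : PruferSurface × Unit => blowDown p.1)
    (Continuous.prodMk_left ())

theorem dense_range_inner : DenseRange inner := by
  intro p
  rcases p with q | ⟨c, u⟩
  · exact subset_closure (mem_range_self q)
  · rw [mem_closure_iff_nhds]
    intro U hU
    obtain ⟨a, b, ε, ha, hb, hε, hs⟩ := mem_nhds_boundary.1 hU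
    have h2 : (0 : ℝ) < ε / 2 := by linarith
    refine ⟨inner ⟨(ε / 2, u * (ε / 2) + c), h2⟩, hs ?_, mem_range_self _⟩
    rw [inner_mem_sector]
    exact ⟨by simp only; nlinarith, by simp only; nlinarith, by simp only; linarith⟩

instance : T2Space PruferSurface := by
  refine ⟨fun p q hpq => ?_⟩
  -- Points with different blow-downs are separated in the plane; distinct points with the same one
  -- lie on a common `ℝ_c` and are separated in its polar chart.
  by_cases h : blowDown p = blowDown q
  · rcases p with p | ⟨c, u⟩ <;> rcases q with q | ⟨d, v⟩
    · exact absurd (congrArg inner (Subtype.ext h)) hpq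
    · exact absurd (congrArg Prod.fst h) p.2.ne'
    · exact absurd (congrArg Prod.fst h).symm q.2.ne'
    · obtain rfl : c = d := congrArg Prod.snd h
      rw [← polar_zero c u, ← polar_zero c v] at hpq ⊢
      let i : ℝ → ClosedHalfPlane := fun u => ⟨(0, u), le_rfl⟩
      have hne : i u ≠ i v := fun h => hpq (congrArg (fun p : ClosedHalfPlane => polar c p) h)
      obtain ⟨U, V, hU, hV, hu, hv, hd⟩ := t2_separation hne
      have e := isOpenEmbedding_polar c
      exact ⟨_, _, e.isOpenMap U hU, e.isOpenMap V hV, mem_image_of_mem _ hu,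
        mem_image_of_mem _ hv, (disjoint_image_iff (polar_injective c)).2 hd⟩
  · obtain ⟨U, V, hU, hV, hu, hv, hd⟩ := t2_separation h
    exact ⟨_, _, hU.preimage continuous_blowDown, hV.preimage continuous_blowDown, hu, hv,
      hd.preimage _⟩

/-! ### Charts in the Euclidean half space -/

/-- The closed half plane as a model of the Euclidean half space of dimension two. -/
noncomputable def halfSpaceHomeomorph : EuclideanHalfSpace 2 ≃ₜ ClosedHalfPlane where
  toFun x := ⟨(x.1 0, x.1 1), x.2⟩
  invFun p := ⟨!₂[p.1.1, p.1.2], by simpa using p.2⟩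
  left_inv x := by
    ext i
    fin_cases i <;> simp
  right_inv p := by
    ext <;> simp
  continuous_toFun := by
    refine Continuous.subtype_mk (Continuous.prodMk ?_ ?_) _
    · exact (EuclideanSpace.proj (𝕜 := ℝ) (0 : Fin 2)).continuous.comp continuous_subtype_val
    · exact (EuclideanSpace.proj (𝕜 := ℝ) (1 : Fin 2)).continuous.comp continuous_subtype_val
  continuous_invFun := by
    refine Continuous.subtype_mk ?_ _
    refine (PiLp.continuous_toLp 2 _).comp (continuous_pi fun i => ?_)
    fin_cases i
    · exact (continuous_fst.comp continuous_subtype_val)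
    · exact (continuous_snd.comp continuous_subtype_val)

/-- The chart of the Prüfer surface around the boundary component `ℝ_c`. -/
noncomputable def polarChart (c : ℝ) :
    OpenPartialHomeomorph PruferSurface (EuclideanHalfSpace 2) :=
  haveI : Nonempty (EuclideanHalfSpace 2) := ⟨0⟩
  (((isOpenEmbedding_polar c).comp
    halfSpaceHomeomorph.isOpenEmbedding).toOpenPartialHomeomorph _).symm

theorem mem_polarChart_source {c : ℝ} {p : PruferSurface} :
    p ∈ (polarChart c).source ↔ p ∈ range fun q : ClosedHalfPlane => polar c q := by
  simp only [polarChart, OpenPartialHomeomorph.symm_source,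
    IsOpenEmbedding.toOpenPartialHomeomorph_target]
  rw [halfSpaceHomeomorph.surjective.range_comp]

noncomputable instance : ChartedSpace (EuclideanHalfSpace 2) PruferSurface where
  atlas := range polarChart
  chartAt p := polarChart (exists_polar p).choose
  mem_chart_source p := mem_polarChart_source.2 (exists_polar p).choose_spec
  chart_mem_atlas _ := mem_range_self _

theorem convex_openHalfPlane : Convex ℝ {q : ℝ × ℝ | 0 < q.1} :=
  convex_halfSpace_gt (f := Prod.fst) ⟨fun _ _ => rfl, fun _ _ => rfl⟩ 0

instance : ContractibleSpace OpenHalfPlane :=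
  convex_openHalfPlane.contractibleSpace ⟨(1, 0), one_pos (α := ℝ)⟩

instance : TopologicalSpace.SeparableSpace PruferSurface :=
  dense_range_inner.separableSpace continuous_inner

/-! ### The complement of the zero points as a non-metrizable surface -/

theorem isClosed_zeroPoints : IsClosed zeroPoints := by
  rw [← isOpen_compl_iff]
  refine isOpen_iff.2 ⟨?_, fun c u hu => ?_⟩
  · have : inner ⁻¹' zeroPointsᶜ = univ := by
      ext q
      simp [zeroPoints]
    rw [this]
    exact isOpen_univ
  · have hu0 : u ≠ 0 := fun h => hu ⟨c, by rw [h]⟩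
    rcases hu0.lt_or_gt with h | h
    · refine ⟨u - 1, 0, 1, by linarith, h, one_pos, ?_⟩
      rintro _ hp ⟨d, rfl⟩
      exact absurd (boundary_mem_sector.1 hp).2.2 (lt_irrefl _)
    · refine ⟨0, u + 1, 1, h, by linarith, one_pos, ?_⟩
      rintro _ hp ⟨d, rfl⟩
      exact absurd (boundary_mem_sector.1 hp).2.1 (lt_irrefl _)

theorem isOpen_compl_zeroPoints : IsOpen zeroPointsᶜ := isClosed_zeroPoints.isOpen_compl

theorem inner_mem_compl_zeroPoints (q : OpenHalfPlane) : inner q ∈ zeroPointsᶜ := by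
  simp [zeroPoints]

theorem boundary_mem_compl_zeroPoints {c u : ℝ} : boundary c u ∈ zeroPointsᶜ ↔ u ≠ 0 := by
  simp [zeroPoints, eq_comm]

theorem isConnected_compl_zeroPoints : IsConnected zeroPointsᶜ := by
  refine (isConnected_range continuous_inner).subset_closure ?_ ?_
  · rintro _ ⟨q, rfl⟩
    exact inner_mem_compl_zeroPoints q
  · rw [dense_range_inner.closure_range]
    exact subset_univ _

theorem isSurfaceWithBoundary_compl_zeroPoints :
    IsSurfaceWithBoundary ↥zeroPointsᶜ where
  t2 := inferInstance
  connected := isConnected_iff_connectedSpace.1 isConnected_compl_zeroPoints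
  charts := ⟨inferInstanceAs (ChartedSpace (EuclideanHalfSpace 2)
    (⟨zeroPointsᶜ, isOpen_compl_zeroPoints⟩ : TopologicalSpace.Opens PruferSurface))⟩

instance : TopologicalSpace.SeparableSpace ↥zeroPointsᶜ :=
  (IsOpen.isOpenEmbedding_subtypeVal isOpen_compl_zeroPoints).separableSpace

/-- A Lindelöf subset meets only countably many boundary components. -/
theorem countable_setOf_boundary_mem {S : Set PruferSurface} (hS : IsLindelof S) :
    {c | ∃ u, boundary c u ∈ S}.Countable := by
  -- Countably many polar charts cover `S`, and each contains just one boundary component.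
  obtain ⟨r, hr, hsub⟩ := hS.elim_countable_subcover _ isOpen_range_polar fun p _ => by
    obtain ⟨c, q, rfl⟩ := exists_polar p
    exact mem_iUnion.2 ⟨c, mem_range_self _⟩
  refine hr.mono ?_
  rintro c ⟨u, hu⟩
  obtain ⟨d, hd, h⟩ := mem_iUnion₂.1 (hsub hu)
  rwa [eq_of_boundary_mem_range_polar h]

theorem not_metrizableSpace_compl_zeroPoints :
    ¬ TopologicalSpace.MetrizableSpace ↥zeroPointsᶜ := by
  intro h
  let _ := TopologicalSpace.metrizableSpaceMetric ↥zeroPointsᶜ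
  have : SecondCountableTopology ↥zeroPointsᶜ := UniformSpace.secondCountable_of_separable _
  have hL : IsLindelof (zeroPointsᶜ : Set PruferSurface) :=
    isLindelof_iff_lindelofSpace.2 inferInstance
  refine Cardinal.not_countable_real ((countable_setOf_boundary_mem hL).mono fun c _ => ?_)
  exact ⟨1, boundary_mem_compl_zeroPoints.2 one_ne_zero⟩

/-! ### Contractibility of the Prüfer surface -/

/-- The map which keeps the ordinates, sends the abscissa `x` to `g x`, and multiplies the slopes
at the boundary points by `r 0`. -/
noncomputable def rescale (g r : ℝ → ℝ) : PruferSurface → PruferSurface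
  | inner q => polar q.1.2 (g q.1.1, 0)
  | boundary c u => polar c (g 0, u * r 0)

/-- The relation `g x * r x = x` says that dividing the slope by the factor that multiplies the
abscissa leaves the ordinate unchanged, so one formula serves in all polar charts. -/
theorem rescale_polar {g r : ℝ → ℝ} (hpos : ∀ x, 0 < x → 0 < g x)
    (hgr : ∀ x, 0 ≤ x → g x * r x = x) {c : ℝ} {p : ℝ × ℝ} (hp : 0 ≤ p.1) :
    rescale g r (polar c p) = polar c (g p.1, p.2 * r p.1) := by
  rcases hp.eq_or_lt with h | h
  · rw [polar_of_le h.ge, rescale, ← h]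
  · rw [polar_of_pos h, rescale, polar_of_pos (p := (g p.1, 0)) (hpos _ h),
      polar_of_pos (p := (g p.1, p.2 * r p.1)) (hpos _ h)]
    congr 3
    simp only
    linear_combination -p.2 * hgr p.1 hp

theorem continuous_rescale {g r : I → ℝ → ℝ} (hpos : ∀ t x, 0 < x → 0 < g t x)
    (hg0 : ∀ t, 0 ≤ g t 0) (hgr : ∀ t x, 0 ≤ x → g t x * r t x = x)
    (hg : ContinuousOn (fun p : I × ℝ => g p.1 p.2) {p | 0 ≤ p.2})
    (hr : ContinuousOn (fun p : I × ℝ => r p.1 p.2) {p | 0 ≤ p.2}) :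
    Continuous fun p : PruferSurface × I => rescale (g p.2) (r p.2) p.1 := by
  have hnn : ∀ t x, 0 ≤ x → 0 ≤ g t x := fun t x hx => by
    rcases hx.eq_or_lt with h | h
    · exact h ▸ hg0 t
    · exact (hpos t x h).le
  refine continuous_of_polar fun c => ?_
  have hm : Continuous fun q : ClosedHalfPlane × I => (q.2, q.1.1.1) := by fun_prop
  have hg' : Continuous fun q : ClosedHalfPlane × I => g q.2 q.1.1.1 :=
    hg.comp_continuous hm fun q => q.1.2
  have hr' : Continuous fun q : ClosedHalfPlane × I => r q.2 q.1.1.1 :=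
    hr.comp_continuous hm fun q => q.1.2
  have : Continuous fun q : ClosedHalfPlane × I =>
      polar c (g q.2 q.1.1.1, q.1.1.2 * r q.2 q.1.1.1) :=
    (continuousOn_polar c).comp_continuous
      (hg'.prodMk ((by fun_prop : Continuous fun q : ClosedHalfPlane × I => q.1.1.2).mul hr'))
      fun q => hnn _ _ q.1.2
  exact this.congr fun q => (rescale_polar (hpos q.2) (hgr q.2) q.1.2).symm

/-- A quotient `n / d` is continuous where `d` vanishes as soon as it is dominated by a
continuous function vanishing there. -/
theorem continuousOn_div_of_abs_le {Y : Type*} [TopologicalSpace Y] {n d b : Y → ℝ} {s : Set Y}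
    (hn : ContinuousOn n s) (hd : ContinuousOn d s) (hb : ContinuousOn b s)
    (hle : ∀ y ∈ s, |n y / d y| ≤ b y) (h0 : ∀ y ∈ s, d y = 0 → b y = 0) :
    ContinuousOn (fun y => n y / d y) s := by
  intro y hy
  by_cases h : d y = 0
  · rw [ContinuousWithinAt, h, div_zero]
    refine squeeze_zero_norm' (eventually_mem_nhdsWithin.mono hle) ?_
    have := hb y hy
    rwa [ContinuousWithinAt, h0 y hy h] at this
  · exact (hn y hy).div (hd y hy) h

/-- The slope factor `r` interpolates between `1` and `√x`. On the boundary it equals `1 - t`, so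
every `ℝ_c` shrinks onto `0_c` while its abscissa stays `0`. -/
theorem homotopic_id_rescale_sqrt :
    ∃ f : C(PruferSurface, PruferSurface), (ContinuousMap.id PruferSurface).Homotopic f ∧
      ∀ p, f p = rescale Real.sqrt Real.sqrt p := by
  let r : I → ℝ → ℝ := fun t x => 1 - t.1 + t.1 * √x
  let g : I → ℝ → ℝ := fun t x => x / r t x
  have hrpos : ∀ t x, 0 < x → 0 < r t x := fun t x hx => by
    have h1 := t.2.1
    have h2 := t.2.2
    have h3 : 0 < √x := Real.sqrt_pos.2 hx
    simp only [r]
    rcases h2.eq_or_lt with h | h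
    · rw [h]
      linarith
    · have := mul_nonneg h1 h3.le
      linarith
  have hr : Continuous fun p : I × ℝ => r p.1 p.2 := by fun_prop
  have hnn : ∀ t x, 0 ≤ x → 0 ≤ r t x := fun t x _ =>
    add_nonneg (sub_nonneg.2 t.2.2) (mul_nonneg t.2.1 (Real.sqrt_nonneg x))
  -- As `r` is a convex combination of `1` and `√x`, the quotient `x / r` is at most the larger of
  -- `x` and `√x`. The bound controls `g` at `t = 1`, `x = 0`, where `r` vanishes.
  have hle : ∀ t x, 0 ≤ x → g t x ≤ x + √x := fun t x hx => by
    rcases hx.eq_or_lt with h | h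
    · simp [g, ← h]
    · have h3 : 0 < √x := Real.sqrt_pos.2 h
      have h4 : √x * √x = x := Real.mul_self_sqrt hx
      rw [div_le_iff₀ (hrpos t x h)]
      have e : (x + √x) * r t x - x = (1 - t.1) * √x + t.1 * x * √x := by
        simp only [r]
        linear_combination t.1 * h4
      have := mul_nonneg (sub_nonneg.2 t.2.2) h3.le
      have := mul_nonneg (mul_nonneg t.2.1 hx) h3.le
      linarith
  have hcont : Continuous fun p : PruferSurface × I => rescale (g p.2) (r p.2) p.1 := by
    refine continuous_rescale (fun t x hx => div_pos hx (hrpos t x hx))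
      (fun t => by simp [g]) (fun t x hx => ?_) ?_ hr.continuousOn
    · rcases hx.eq_or_lt with h | h
      · simp [g, ← h]
      · exact div_mul_cancel₀ _ (hrpos t x h).ne'
    · refine continuousOn_div_of_abs_le (b := fun p => p.2 + √p.2) continuousOn_snd
        hr.continuousOn (by fun_prop) ?_ ?_
      · rintro ⟨t, x⟩ hx
        rw [abs_of_nonneg (div_nonneg hx (hnn t x hx))]
        exact hle t x hx
      · rintro ⟨t, x⟩ hx h
        have : x = 0 := by
          by_contra h'
          exact (hrpos t x (lt_of_le_of_ne hx (Ne.symm h'))).ne' h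
        simp [this]
  refine ⟨⟨fun p => rescale (g 1) (r 1) p, by
    exact hcont.comp (Continuous.prodMk_left 1)⟩, ⟨⟨⟨fun p => rescale (g p.1) (r p.1) p.2, by
    exact hcont.comp continuous_swap⟩, fun p => ?_, fun p => rfl⟩⟩, fun p => ?_⟩
  · rcases p with q | ⟨c, u⟩
    · simp only [rescale, g, r]
      have hq : 0 < q.1.1 := q.2
      simp [polar, hq]
    · simp [rescale, g, r]
  · rcases p with q | ⟨c, u⟩
    · simp [rescale, g, r]
    · simp [rescale, g, r]

/-- Once the slopes on the boundary are collapsed to `0`, the abscissa `√x` can be increased to `√x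
+ 1`, which is positive everywhere. -/
theorem exists_homotopic_rescale_sqrt_comp_inner (f : C(PruferSurface, PruferSurface))
    (hf : ∀ p, f p = rescale Real.sqrt Real.sqrt p) :
    ∃ k : C(PruferSurface, OpenHalfPlane),
      f.Homotopic ((⟨inner, continuous_inner⟩ : C(OpenHalfPlane, PruferSurface)).comp k) := by
  let g : I → ℝ → ℝ := fun t x => √x + t.1
  let r : I → ℝ → ℝ := fun t x => x / g t x
  have hpos : ∀ t x, 0 < x → 0 < g t x := fun t x hx =>
    add_pos_of_pos_of_nonneg (Real.sqrt_pos.2 hx) t.2.1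
  have hg : Continuous fun p : I × ℝ => g p.1 p.2 := by fun_prop
  have hle : ∀ t x, 0 ≤ x → r t x ≤ √x := fun t x hx => by
    rcases hx.eq_or_lt with h | h
    · simp [r, ← h]
    · rw [div_le_iff₀ (hpos t x h)]
      have := mul_nonneg (Real.sqrt_nonneg x) t.2.1
      simp only [g]
      linarith [Real.mul_self_sqrt hx, mul_add √x √x t.1]
  have hcont : Continuous fun p : PruferSurface × I => rescale (g p.2) (r p.2) p.1 := by
    refine continuous_rescale hpos (fun t => by simpa [g] using t.2.1) (fun t x hx => ?_)
      hg.continuousOn ?_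
    · rcases hx.eq_or_lt with h | h
      · simp [r, ← h]
      · exact mul_div_cancel₀ _ (hpos t x h).ne'
    · refine continuousOn_div_of_abs_le (b := fun p => √p.2) continuousOn_snd
        hg.continuousOn (by fun_prop) ?_ ?_
      · rintro ⟨t, x⟩ hx
        rw [abs_of_nonneg (div_nonneg hx (add_nonneg (Real.sqrt_nonneg x) t.2.1))]
        exact hle t x hx
      · rintro ⟨t, x⟩ hx h
        exact le_antisymm (by linarith [t.2.1, show √x + t.1 = 0 from h]) (Real.sqrt_nonneg x)
  let k : PruferSurface → OpenHalfPlane := fun p =>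
    ⟨(√(blowDown p).1 + 1, (blowDown p).2), add_pos_of_nonneg_of_pos (Real.sqrt_nonneg _) one_pos⟩
  have hk : Continuous k := by
    have := continuous_blowDown
    exact Continuous.subtype_mk (by fun_prop) _
  refine ⟨⟨k, hk⟩, ⟨⟨⟨fun p => rescale (g p.1) (r p.1) p.2, by
    exact hcont.comp continuous_swap⟩, fun p => ?_, fun p => ?_⟩⟩⟩
  · rw [hf]
    rcases p with q | ⟨c, u⟩ <;> simp [rescale, g, r]
  · rcases p with q | ⟨c, u⟩
    · have : 0 < √q.1.1 + 1 := add_pos_of_nonneg_of_pos (Real.sqrt_nonneg _) one_pos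
      simp [rescale, g, k, polar, this]
    · simp [rescale, g, r, k, polar]

instance : ContractibleSpace PruferSurface := by
  obtain ⟨f, hf, hf'⟩ := homotopic_id_rescale_sqrt
  obtain ⟨k, hk⟩ := exists_homotopic_rescale_sqrt_comp_inner f hf'
  rw [contractible_iff_id_nullhomotopic]
  obtain ⟨y, hy⟩ := ((id_nullhomotopic OpenHalfPlane).comp_right
    (⟨inner, continuous_inner⟩ : C(OpenHalfPlane, PruferSurface))).comp_left k
  exact ⟨y, (hf.trans hk).trans hy⟩

theorem isSurfaceWithBoundary : IsSurfaceWithBoundary PruferSurface where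
  t2 := inferInstance
  connected := inferInstance
  charts := ⟨inferInstance⟩

/-! ### Pushing compact sets off the boundary -/

/-- The point of the open half plane with the given coordinates, extended to the whole plane. -/
noncomputable def innerExt (q : ℝ × ℝ) : PruferSurface := polar q.2 (q.1, 0)

theorem innerExt_of_pos {q : ℝ × ℝ} (h : 0 < q.1) : innerExt q = inner ⟨q, h⟩ := by
  rw [innerExt, polar_of_pos (p := (q.1, 0)) h]
  simp

theorem continuousAt_innerExt {q : ℝ × ℝ} (h : 0 < q.1) : ContinuousAt innerExt q := by
  refine ContinuousOn.continuousAt (s := {q : ℝ × ℝ | 0 < q.1}) ?_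
    ((isOpen_lt continuous_const continuous_fst).mem_nhds h)
  rw [continuousOn_iff_continuous_domRestrict]
  exact continuous_inner.congr fun q => (innerExt_of_pos q.2).symm

/-- A bump of height `δ` at the point `⟨0, c⟩`. -/
noncomputable def bump (δ c : ℝ) (q : ℝ × ℝ) : ℝ := max 0 (δ - q.1 - |q.2 - c|)

@[fun_prop]
theorem continuous_bump (δ c : ℝ) : Continuous (bump δ c) := by
  unfold bump
  fun_prop

theorem bump_nonneg (δ c : ℝ) (q : ℝ × ℝ) : 0 ≤ bump δ c q := le_max_left _ _

/-- Push the points near the boundary components `ℝ_c`, `c ∈ F`, into the open half plane along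
the lines through `⟨0, c⟩`. -/
noncomputable def push (F : Finset ℝ) (δ t : ℝ) : PruferSurface → PruferSurface
  | inner q => innerExt (q.1.1 + t * ∑ c ∈ F, bump δ c q.1,
      q.1.2 + t * (∑ c ∈ F, bump δ c q.1 * (q.1.2 - c)) / q.1.1)
  | boundary c u => polar c (t * δ, u)

/-- The bumps at the other points of `F` vanish near `⟨0, d⟩` because `δ < |c - d|`. The remaining
displacement is parallel to `(1, u)` with `u` the slope at `d`, so the slope is preserved. -/
theorem push_polar_eventually {F : Finset ℝ} {δ : ℝ} (hδ : 0 < δ)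
    (hF : ∀ c ∈ F, ∀ d ∈ F, c ≠ d → δ < |c - d|) {d : ℝ} (hd : d ∈ F) {p : ClosedHalfPlane}
    (hp : p.1.1 = 0) : ∀ᶠ q : ClosedHalfPlane in 𝓝 p, ∀ t : ℝ, 0 ≤ t →
      push F δ t (polar d q) =
        polar d (q.1.1 + t * bump δ d (q.1.1, q.1.2 * q.1.1 + d), q.1.2) := by
  have key : ∀ᶠ q : ClosedHalfPlane in 𝓝 p, ∀ c ∈ F, c ≠ d →
      bump δ c (q.1.1, q.1.2 * q.1.1 + d) = 0 := by
    rw [Filter.eventually_all_finset]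
    intro c hc
    by_cases hcd : c = d
    · exact .of_forall fun _ h => absurd hcd h
    · have : ∀ᶠ q : ClosedHalfPlane in 𝓝 p, δ - q.1.1 - |q.1.2 * q.1.1 + d - c| < 0 := by
        refine ContinuousAt.eventually_lt (by fun_prop) (by fun_prop) ?_
        have := hF d hd c hc (Ne.symm hcd)
        rw [hp, mul_zero, zero_add]
        linarith
      filter_upwards [this] with q hq _
      exact max_eq_left hq.le
  filter_upwards [key] with q hq t ht
  rcases q.2.eq_or_lt with h | h
  · rw [polar_of_le h.ge, push, ← h]
    simp [bump, hδ.le]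
  · have hpos : 0 < q.1.1 + t * bump δ d (q.1.1, q.1.2 * q.1.1 + d) :=
      add_pos_of_pos_of_nonneg h (mul_nonneg ht (bump_nonneg _ _ _))
    rw [polar_of_pos h, push]
    simp only
    rw [Finset.sum_eq_single_of_mem d hd fun c hc hcd => hq c hc hcd,
      Finset.sum_eq_single_of_mem d hd fun c hc hcd => by rw [hq c hc hcd, zero_mul],
      polar_of_pos (p := (q.1.1 + t * bump δ d (q.1.1, q.1.2 * q.1.1 + d), q.1.2)) hpos,
      innerExt_of_pos (q := (_, _)) hpos]
    congr 3
    simp only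
    field_simp
    ring

/-- Only charts at points of `F` are considered: near `ℝ_c` with `c ∉ F` the map need not be
continuous. At interior points of the chart, the explicit formula has nonzero denominator. -/
theorem continuousAt_push {F : Finset ℝ} {δ : ℝ} (hδ : 0 < δ)
    (hF : ∀ c ∈ F, ∀ d ∈ F, c ≠ d → δ < |c - d|) {d : ℝ} (hd : d ∈ F) (p : ClosedHalfPlane)
    (t : I) : ContinuousAt (fun z : PruferSurface × I => push F δ z.2 z.1) (polar d p, t) := by
  apply continuousAt_of_polar
  rcases p.2.eq_or_lt with h | h
  · have hev := (push_polar_eventually hδ hF hd h.symm).prod_inl_nhds t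
    have hc : Continuous fun q : ClosedHalfPlane × I =>
        polar d (q.1.1.1 + q.2 * bump δ d (q.1.1.1, q.1.1.2 * q.1.1.1 + d), q.1.1.2) :=
      (continuousOn_polar d).comp_continuous (by fun_prop) fun q =>
        add_nonneg q.1.2 (mul_nonneg q.2.2.1 (bump_nonneg _ _ _))
    refine hc.continuousAt.congr ?_
    filter_upwards [hev] with q hq
    exact (hq q.2 q.2.2.1).symm
  · let e : ClosedHalfPlane × I → ℝ × ℝ := fun q => (q.1.1.1, q.1.1.2 * q.1.1.1 + d)
    have he : Continuous e := by fun_prop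
    have hpos : ∀ᶠ q : ClosedHalfPlane × I in 𝓝 (p, t), 0 < q.1.1.1 :=
      ContinuousAt.eventually_lt (by fun_prop) (by fun_prop) h
    have hc : ContinuousAt (fun q : ClosedHalfPlane × I =>
        innerExt ((e q).1 + q.2 * ∑ c ∈ F, bump δ c (e q),
          (e q).2 + q.2 * (∑ c ∈ F, bump δ c (e q) * ((e q).2 - c)) / (e q).1)) (p, t) := by
      refine ContinuousAt.comp' (g := innerExt) (continuousAt_innerExt ?_) ?_
      · exact add_pos_of_pos_of_nonneg h
          (mul_nonneg t.2.1 (Finset.sum_nonneg fun c _ => bump_nonneg _ _ _))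
      · refine ContinuousAt.prodMk (by fun_prop) (ContinuousAt.add (by fun_prop) ?_)
        exact ContinuousAt.div (by fun_prop) (by fun_prop) h.ne'
    refine hc.congr ?_
    filter_upwards [hpos] with q hq
    rw [polar_of_pos hq, push]

theorem push_zero (F : Finset ℝ) (δ : ℝ) (p : PruferSurface) : push F δ 0 p = p := by
  rcases p with q | ⟨c, u⟩
  · have : 0 < (q.1.1, q.1.2).1 := q.2
    simp only [push, zero_mul, add_zero, zero_div]
    rw [innerExt_of_pos this]
  · simp [push]

theorem push_mem_range_inner (F : Finset ℝ) {δ t : ℝ} (hδ : 0 < δ) (ht : 0 < t)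
    (p : PruferSurface) : push F δ t p ∈ range inner := by
  rcases p with q | ⟨c, u⟩
  · have : 0 < q.1.1 + t * ∑ c ∈ F, bump δ c q.1 := add_pos_of_pos_of_nonneg q.2
      (mul_nonneg ht.le (Finset.sum_nonneg fun c _ => bump_nonneg _ _ _))
    rw [push, innerExt_of_pos (q := (_, _)) this]
    exact mem_range_self _
  · rw [push, polar_of_pos (p := (_, _)) (mul_pos ht hδ)]
    exact mem_range_self _

theorem range_inner_subset : range inner ⊆ zeroPointsᶜ := by
  rintro _ ⟨q, rfl⟩
  exact inner_mem_compl_zeroPoints q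

/-- Maps from compact spaces can be pushed instantly into the open half plane. -/
theorem exists_push {Y : Type*} [TopologicalSpace Y] [CompactSpace Y] (f : C(Y, ↥zeroPointsᶜ)) :
    ∃ D : C(I × Y, ↥zeroPointsᶜ), (∀ y, D (0, y) = f y) ∧
      ∀ t y, t ≠ 0 → (D (t, y)).1 ∈ range inner := by
  let f' : C(Y, PruferSurface) := ⟨fun y => f y, by fun_prop⟩
  -- By compactness finitely many polar charts contain the image; their base points are the places
  -- that need a bump.
  obtain ⟨F, hF⟩ := (isCompact_range f'.continuous).elim_finite_subcover _ isOpen_range_polar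
    fun p _ => by
      obtain ⟨c, q, rfl⟩ := exists_polar p
      exact mem_iUnion.2 ⟨c, mem_range_self _⟩
  -- Any positive number below all the finitely many gaps in `F` will do.
  obtain ⟨δ, hδF, hδ⟩ : ∃ δ : ℝ, (∀ e ∈ F.offDiag, δ < |e.1 - e.2|) ∧ 0 < δ := by
    have h1 : ∀ᶠ δ : ℝ in 𝓝[>] 0, ∀ e ∈ F.offDiag, δ < |e.1 - e.2| := by
      rw [Filter.eventually_all_finset]
      intro e he
      exact nhdsWithin_le_nhds
        (Iio_mem_nhds (abs_pos.2 (sub_ne_zero.2 (Finset.mem_offDiag.1 he).2.2)))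
    exact (h1.and self_mem_nhdsWithin).exists
  have hδ' : ∀ c ∈ F, ∀ d ∈ F, c ≠ d → δ < |c - d| := fun c hc d hd h =>
    hδF (c, d) (Finset.mem_offDiag.2 ⟨hc, hd, h⟩)
  have hcont : Continuous fun z : I × Y => push F δ z.1 (f' z.2) := by
    rw [continuous_iff_continuousAt]
    rintro ⟨t, y⟩
    obtain ⟨d, hd, p, hp⟩ := mem_iUnion₂.1 (hF (mem_range_self y))
    have := continuousAt_push hδ hδ' hd p t
    rw [show polar d p = f' y from hp] at this
    exact ContinuousAt.comp (f := fun z : I × Y => (f' z.2, z.1)) (x := (t, y)) this (by fun_prop)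
  have hmem : ∀ z : I × Y, push F δ z.1 (f' z.2) ∈ zeroPointsᶜ := fun z => by
    rcases z.1.2.1.eq_or_lt with h | h
    · rw [← h, push_zero]
      exact (f z.2).2
    · exact range_inner_subset (push_mem_range_inner F hδ h _)
  refine ⟨⟨fun z => ⟨push F δ z.1 (f' z.2), hmem z⟩, hcont.subtype_mk _⟩, fun y => ?_,
    fun t y ht => ?_⟩
  · exact Subtype.ext (push_zero _ _ _)
  · exact push_mem_range_inner F hδ (unitInterval.pos_iff_ne_zero.2 ht) _

/-! ### Straight-line homotopies and vanishing of the homotopy groups -/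

open Classical in
/-- The straight line from `p` to `q` in the open half plane, constant if `p = q`. -/
noncomputable def segmentMap (p q : PruferSurface) (t : ℝ) : PruferSurface :=
  if p = q then p else innerExt (AffineMap.lineMap (blowDown p) (blowDown q) t)

theorem lineMap_fst_pos (p q : OpenHalfPlane) (t : I) :
    0 < (AffineMap.lineMap (k := ℝ) p.1 q.1 (t : ℝ)).1 :=
  convex_openHalfPlane.lineMap_mem p.2 q.2 t.2

theorem segmentMap_inner (p q : OpenHalfPlane) (t : I) :
    segmentMap (inner p) (inner q) t = inner ⟨_, lineMap_fst_pos p q t⟩ := by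
  unfold segmentMap
  split_ifs with h
  · have := inner_injective h
    subst this
    congr 1
    ext <;> simp
  · rw [blowDown_inner, blowDown_inner, innerExt_of_pos (lineMap_fst_pos p q t)]

theorem segmentMap_self (p : PruferSurface) (t : ℝ) : segmentMap p p t = p := if_pos rfl

theorem convex_sector (c a b ε : ℝ) :
    Convex ℝ {q : ℝ × ℝ | a * q.1 + c < q.2 ∧ q.2 < b * q.1 + c ∧ q.1 < ε} := by
  rintro p ⟨p1, p2, p3⟩ q ⟨q1, q2, q3⟩ s t hs ht hst
  simp only [mem_ofPred_eq, Prod.fst_add, Prod.smul_fst, smul_eq_mul, Prod.snd_add, Prod.smul_snd]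
  obtain rfl : s = 1 - t := by linarith
  rcases ht.eq_or_lt with h | h
  · simp only [← h]
    exact ⟨by linarith, by linarith, by linarith⟩
  · exact ⟨by nlinarith, by nlinarith, by nlinarith⟩

theorem segmentMap_mem_sector {c a b ε : ℝ} {p q : PruferSurface} (hp : p ∈ sector c a b ε)
    (hq : q ∈ sector c a b ε) (h : p = q ∨ p ∈ range inner ∧ q ∈ range inner) (t : I) :
    segmentMap p q t ∈ sector c a b ε := by
  rcases h with rfl | ⟨⟨p, rfl⟩, ⟨q, rfl⟩⟩
  · rwa [segmentMap_self]
  · rw [inner_mem_sector] at hp hq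
    rw [segmentMap_inner, inner_mem_sector]
    exact (convex_sector c a b ε).lineMap_mem hp hq t.2

/-- Where both maps are in the open half plane this is continuity of affine combinations. At a
common boundary value it holds because basic neighbourhoods are sectors, whose interior parts are
convex. -/
theorem continuous_segmentMap {Y : Type*} [TopologicalSpace Y] {A B : Y → PruferSurface}
    (hA : Continuous A) (hB : Continuous B)
    (h : ∀ y, A y = B y ∨ A y ∈ range inner ∧ B y ∈ range inner) :
    Continuous fun z : I × Y => segmentMap (A z.2) (B z.2) z.1 := by
  rw [continuous_iff_continuousAt]
  rintro ⟨t, y⟩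
  have hA' : Continuous fun z : I × Y => A z.2 := hA.comp continuous_snd
  have hB' : Continuous fun z : I × Y => B z.2 := hB.comp continuous_snd
  by_cases hy : A y ∈ range inner ∧ B y ∈ range inner
  · have hev : ∀ᶠ z : I × Y in 𝓝 (t, y), A z.2 ∈ range inner ∧ B z.2 ∈ range inner :=
      (hA'.continuousAt.eventually_mem (isOpenEmbedding_inner.isOpen_range.mem_nhds hy.1)).and
        (hB'.continuousAt.eventually_mem (isOpenEmbedding_inner.isOpen_range.mem_nhds hy.2))
    have hc : ContinuousAt (fun z : I × Y => innerExt
        (AffineMap.lineMap (blowDown (A z.2)) (blowDown (B z.2)) (z.1 : ℝ))) (t, y) := by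
      refine ContinuousAt.comp' (g := innerExt) (continuousAt_innerExt ?_) ?_
      · obtain ⟨⟨p, hp⟩, ⟨q, hq⟩⟩ := hy
        rw [← hp, ← hq]
        exact lineMap_fst_pos p q t
      · have h1 := continuous_blowDown.comp hA'
        have h2 := continuous_blowDown.comp hB'
        simp only [AffineMap.lineMap_apply_module]
        simp only [Function.comp_def] at h1 h2
        fun_prop
    refine hc.congr ?_
    filter_upwards [hev] with z ⟨⟨p, hp⟩, ⟨q, hq⟩⟩
    rw [← hp, ← hq, segmentMap_inner]
    exact innerExt_of_pos (lineMap_fst_pos p q z.1)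
  · have hAB : A y = B y := (h y).resolve_right hy
    obtain ⟨c, u, hcu⟩ : ∃ c u, A y = boundary c u := by
      rcases hAy : A y with q | ⟨c, u⟩
      · exact absurd ⟨⟨q, hAy.symm⟩, ⟨q, hAB ▸ hAy.symm⟩⟩ hy
      · exact ⟨c, u, rfl⟩
    rw [ContinuousAt]
    simp only
    rw [← hAB, segmentMap_self, hcu]
    intro U hU
    rw [mem_map]
    obtain ⟨a, b, ε, ha, hb, hε, hs⟩ := mem_nhds_boundary.1 hU
    have hm : sector c a b ε ∈ 𝓝 (boundary c u) := (isOpen_sector hε).mem_nhds (by simp [ha, hb])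
    have e1 : ∀ᶠ z : I × Y in 𝓝 (t, y), A z.2 ∈ sector c a b ε :=
      hA'.continuousAt.eventually_mem (by rwa [hcu])
    have e2 : ∀ᶠ z : I × Y in 𝓝 (t, y), B z.2 ∈ sector c a b ε :=
      hB'.continuousAt.eventually_mem (by rwa [← hAB, hcu])
    filter_upwards [e1, e2] with z h1 h2
    exact hs (segmentMap_mem_sector h1 h2 (h z.2) z.1)

/-- Maps into the complement of the `0`-points which agree on a set and map its complement into
the open half plane are homotopic relative to this set. -/
theorem homotopicRel_of_mem_range_inner {Y : Type*} [TopologicalSpace Y]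
    {A B : C(Y, ↥zeroPointsᶜ)} {S : Set Y} (hS : ∀ y ∈ S, A y = B y)
    (h : ∀ y ∉ S, (A y).1 ∈ range inner ∧ (B y).1 ∈ range inner) : A.HomotopicRel B S := by
  have hAB : ∀ y, (A y).1 = (B y).1 ∨ (A y).1 ∈ range inner ∧ (B y).1 ∈ range inner := fun y => by
    by_cases hy : y ∈ S
    · exact .inl (congrArg _ (hS y hy))
    · exact .inr (h y hy)
  have hcont := continuous_segmentMap (A := fun y => (A y).1) (B := fun y => (B y).1)
    (by fun_prop) (by fun_prop) hAB
  have hmem : ∀ z : I × Y, segmentMap (A z.2).1 (B z.2).1 z.1 ∈ zeroPointsᶜ := fun z => by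
    rcases hAB z.2 with h | ⟨⟨p, hp⟩, ⟨q, hq⟩⟩
    · rw [← h, segmentMap_self]
      exact (A z.2).2
    · rw [← hp, ← hq, segmentMap_inner]
      exact inner_mem_compl_zeroPoints _
  refine ⟨⟨⟨⟨fun z => ⟨segmentMap (A z.2).1 (B z.2).1 z.1, hmem z⟩, hcont.subtype_mk _⟩,
    fun y => ?_, fun y => ?_⟩, fun t y hy => ?_⟩⟩
  · refine Subtype.ext ?_
    rcases hAB y with h | ⟨⟨p, hp⟩, ⟨q, hq⟩⟩
    · simp only [← h, segmentMap_self]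
    · simp only [← hp, ← hq, segmentMap_inner]
      simp
  · refine Subtype.ext ?_
    rcases hAB y with h | ⟨⟨p, hp⟩, ⟨q, hq⟩⟩
    · simp only [← h, segmentMap_self]
    · simp only [← hp, ← hq, segmentMap_inner]
      simp
  · refine Subtype.ext ?_
    simp only [ContinuousMap.coe_mk]
    rw [hS y hy, segmentMap_self]

theorem exists_continuous_zero_iff_mem_boundary (N : Type*) [Fintype N] :
    ∃ m : C(N → I, I), ∀ z, m z = 0 ↔ z ∈ Cube.boundary N := by
  -- For the `0`-dimensional cube the product is empty, equal to `1`, in agreement with the empty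
  -- boundary.
  refine ⟨⟨fun z => ∏ i, z i * σ (z i), by fun_prop⟩, fun z => ?_⟩
  simp only [ContinuousMap.coe_mk, Finset.prod_eq_zero_iff, Finset.mem_univ, true_and, mul_eq_zero,
    unitInterval.symm_eq_zero, Cube.boundary, mem_ofPred_eq]

/-- Each loop is pushed into the open half plane for a time `m z` vanishing exactly on the boundary
of the cube. The base point, which may lie on some `ℝ_c`, thus stays fixed, and two pushed loops are
joined by segments. -/
theorem subsingleton_homotopyGroup {N : Type*} [Fintype N] (x : ↥zeroPointsᶜ) :
    Subsingleton (HomotopyGroup N ↥zeroPointsᶜ x) := by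
  obtain ⟨m, hm⟩ := exists_continuous_zero_iff_mem_boundary N
  have key : ∀ f : GenLoop N ↥zeroPointsᶜ x, ∃ E : C(N → I, ↥zeroPointsᶜ),
      (∀ z ∈ Cube.boundary N, E z = x) ∧ (∀ z ∉ Cube.boundary N, (E z).1 ∈ range inner) ∧
      f.1.HomotopicRel E (Cube.boundary N) := by
    intro f
    obtain ⟨D, hD0, hD⟩ := exists_push f.1
    have hb : ∀ z ∈ Cube.boundary N, ∀ t : I, D (t * m z, z) = f.1 z := fun z hz t => by
      rw [(hm z).2 hz, mul_zero, hD0]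
    refine ⟨⟨fun z => D (m z, z), by fun_prop⟩, fun z hz => ?_, fun z hz => ?_,
      ⟨⟨⟨⟨fun p => D (p.1 * m p.2, p.2), by fun_prop⟩, fun z => ?_, fun z => ?_⟩,
        fun t z hz => ?_⟩⟩⟩
    · have := hb z hz 1
      rw [one_mul] at this
      exact this.trans (f.2 z hz)
    · exact hD _ _ fun h => hz ((hm z).1 h)
    · simp [hD0]
    · simp
    · exact hb z hz t
  refine ⟨fun a b => ?_⟩
  induction a using Quotient.inductionOn with | h f => ?_
  induction b using Quotient.inductionOn with | h g => ?_
  obtain ⟨E, hE, hE', hfE⟩ := key f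
  obtain ⟨G, hG, hG', hgG⟩ := key g
  refine Quotient.sound (hfE.trans (.trans ?_ hgG.symm))
  exact homotopicRel_of_mem_range_inner (fun z hz => (hE z hz).trans (hG z hz).symm)
    fun z hz => ⟨hE' z hz, hG' z hz⟩

/-! ### Rigidity of maps homotopic to the identity -/

/-- The part of the Prüfer surface above the line through `⟨0, c⟩` with slope `0`, together with
the positive half of `ℝ_c`. -/
def upperSide (c : ℝ) : Set PruferSurface :=
  inner '' {q | c < q.1.2} ∪ boundary c '' Ioi 0

/-- The part of the Prüfer surface below the line through `⟨0, c⟩` with slope `0`, together with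
the negative half of `ℝ_c`. -/
def lowerSide (c : ℝ) : Set PruferSurface :=
  inner '' {q | q.1.2 < c} ∪ boundary c '' Iio 0

@[simp] theorem inner_mem_upperSide {c : ℝ} {q : OpenHalfPlane} :
    inner q ∈ upperSide c ↔ c < q.1.2 := by
  simp [upperSide, -Subtype.exists]

@[simp] theorem inner_mem_lowerSide {c : ℝ} {q : OpenHalfPlane} :
    inner q ∈ lowerSide c ↔ q.1.2 < c := by
  simp [lowerSide, -Subtype.exists]

@[simp] theorem boundary_mem_upperSide {c d u : ℝ} :
    boundary d u ∈ upperSide c ↔ c = d ∧ 0 < u := by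
  simp [upperSide, and_comm]

@[simp] theorem boundary_mem_lowerSide {c d u : ℝ} :
    boundary d u ∈ lowerSide c ↔ c = d ∧ u < 0 := by
  simp [lowerSide, and_comm]

theorem isOpen_upperSide (c : ℝ) : IsOpen (upperSide c) := by
  refine isOpen_iff.2 ⟨?_, fun d u hu => ?_⟩
  · have : inner ⁻¹' upperSide c = {q | c < q.1.2} := by
      ext q
      simp
    rw [this]
    exact isOpen_lt (by fun_prop) (by fun_prop)
  · obtain ⟨rfl, hu'⟩ := boundary_mem_upperSide.1 hu
    refine ⟨0, u + 1, 1, hu', by linarith, one_pos, ?_⟩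
    rintro (q | ⟨d, v⟩) h
    · rw [inner_mem_sector] at h
      exact inner_mem_upperSide.2 (by linarith [h.1])
    · rw [boundary_mem_sector] at h
      exact boundary_mem_upperSide.2 ⟨h.1.symm, h.2.1⟩

theorem isOpen_lowerSide (c : ℝ) : IsOpen (lowerSide c) := by
  refine isOpen_iff.2 ⟨?_, fun d u hu => ?_⟩
  · have : inner ⁻¹' lowerSide c = {q | q.1.2 < c} := by
      ext q
      simp
    rw [this]
    exact isOpen_lt (by fun_prop) (by fun_prop)
  · obtain ⟨rfl, hu'⟩ := boundary_mem_lowerSide.1 hu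
    refine ⟨u - 1, 0, 1, by linarith, hu', one_pos, ?_⟩
    rintro (q | ⟨d, v⟩) h
    · rw [inner_mem_sector] at h
      exact inner_mem_lowerSide.2 (by linarith [h.2.1])
    · rw [boundary_mem_sector] at h
      exact boundary_mem_lowerSide.2 ⟨h.1.symm, h.2.2⟩

theorem disjoint_upperSide_lowerSide (c : ℝ) : Disjoint (upperSide c) (lowerSide c) := by
  rw [Set.disjoint_left]
  rintro (q | ⟨d, v⟩) h1 h2
  · exact lt_asymm (inner_mem_upperSide.1 h1) (inner_mem_lowerSide.1 h2)
  · exact lt_asymm (boundary_mem_upperSide.1 h1).2 (boundary_mem_lowerSide.1 h2).2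

theorem le_of_mem_upperSide {c : ℝ} {p : PruferSurface} (h : p ∈ upperSide c) :
    c ≤ (blowDown p).2 := by
  rcases p with q | ⟨d, v⟩
  · exact (inner_mem_upperSide.1 h).le
  · exact (boundary_mem_upperSide.1 h).1.le

theorem le_of_mem_lowerSide {c : ℝ} {p : PruferSurface} (h : p ∈ lowerSide c) :
    (blowDown p).2 ≤ c := by
  rcases p with q | ⟨d, v⟩
  · exact (inner_mem_lowerSide.1 h).le
  · exact (boundary_mem_lowerSide.1 h).1.ge

/-- The boundary component `ℝ_c`. -/
def boundaryLine (c : ℝ) : Set PruferSurface := blowDown ⁻¹' {(0, c)}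

theorem isClosed_boundaryLine (c : ℝ) : IsClosed (boundaryLine c) :=
  isClosed_singleton.preimage continuous_blowDown

theorem mem_boundaryLine {c : ℝ} {p : PruferSurface} :
    p ∈ boundaryLine c ↔ ∃ u, boundary c u = p := by
  rcases p with q | ⟨d, v⟩
  · simp only [boundaryLine, mem_preimage, blowDown_inner, mem_singleton_iff, reduceCtorEq,
      exists_false, iff_false]
    exact fun h => q.2.ne' (congrArg Prod.fst h)
  · simp [boundaryLine, eq_comm]

theorem mem_boundaryLine_of_mem_upperSide {c : ℝ} {p : PruferSurface} (h : p ∈ upperSide c)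
    (hle : (blowDown p).2 ≤ c) : p ∈ boundaryLine c := by
  rcases p with q | ⟨d, v⟩
  · exact absurd (inner_mem_upperSide.1 h) hle.not_gt
  · exact mem_boundaryLine.2 ⟨v, by rw [(boundary_mem_upperSide.1 h).1]⟩

theorem mem_boundaryLine_of_mem_lowerSide {c : ℝ} {p : PruferSurface} (h : p ∈ lowerSide c)
    (hle : c ≤ (blowDown p).2) : p ∈ boundaryLine c := by
  rcases p with q | ⟨d, v⟩
  · exact absurd (inner_mem_lowerSide.1 h) hle.not_gt
  · exact mem_boundaryLine.2 ⟨v, by rw [(boundary_mem_lowerSide.1 h).1]⟩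

/-- The removal of `0_c` is essential here: it splits what remains of `ℝ_c` between two disjoint
open sets. -/
theorem mem_sides_of_mem_boundaryLine {c : ℝ} {p : PruferSurface} (h : p ∈ boundaryLine c)
    (hp : p ∈ zeroPointsᶜ) : p ∈ upperSide c ∨ p ∈ lowerSide c := by
  obtain ⟨u, rfl⟩ := mem_boundaryLine.1 h
  rcases (boundary_mem_compl_zeroPoints.1 hp).lt_or_gt with hu | hu
  · exact .inr (boundary_mem_lowerSide.2 ⟨rfl, hu⟩)
  · exact .inl (boundary_mem_upperSide.2 ⟨rfl, hu⟩)

/-- The point `u` of the boundary component `ℝ_c`, for `u ≠ 0`. -/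
def nonzeroPoint (c : ℝ) {u : ℝ} (hu : u ≠ 0) : ↥zeroPointsᶜ :=
  ⟨boundary c u, boundary_mem_compl_zeroPoints.2 hu⟩

/-- The points of the open half plane. -/
def innerPoint (x y : ℝ) (hx : 0 < x) : ↥zeroPointsᶜ :=
  ⟨inner ⟨(x, y), hx⟩, inner_mem_compl_zeroPoints _⟩

theorem exists_innerPoint_mem {c u : ℝ} {hu : u ≠ 0} {U : Set ↥zeroPointsᶜ}
    (hU : U ∈ 𝓝 (nonzeroPoint c hu)) :
    ∃ ε > 0, ∀ x (hx : 0 < x), x < ε → innerPoint x (u * x + c) hx ∈ U := by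
  obtain ⟨V, hV, hVU⟩ := (mem_nhds_subtype _ _ _).1 hU
  obtain ⟨a, b, ε, ha, hb, hε, hs⟩ := mem_nhds_boundary.1 hV
  refine ⟨ε, hε, fun x hx hxε => hVU (hs ?_)⟩
  simp only [innerPoint, inner_mem_sector]
  exact ⟨by nlinarith, by nlinarith, hxε⟩

/-- For fixed `ε = 1 / (n + 1)` the intervals `(c, c + ε)` are pairwise disjoint, so there are
countably many; monotonicity reduces every `ε` to one of these. -/
theorem _root_.Set.countable_of_separated {P : ℝ → ℝ → Prop}
    (hmono : ∀ ε ε' c, 0 < ε' → ε' ≤ ε → P ε c → P ε' c)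
    (hsep : ∀ ε c d, P ε c → P ε d → c < d → d < c + ε → False) :
    {c | ∃ ε > 0, P ε c}.Countable := by
  have hcount : ∀ n : ℕ, {c | P (1 / (n + 1)) c}.Countable := fun n => by
    have hn : (0 : ℝ) < 1 / (n + 1) := Nat.one_div_pos_of_nat
    refine Set.PairwiseDisjoint.countable_of_Ioo (y := fun c : ℝ => c + 1 / (n + 1)) ?_
      fun c _ => lt_add_of_pos_right c hn
    intro c hc d hd hcd
    rw [Function.onFun, Set.disjoint_left]
    rintro z ⟨h1, h2⟩ ⟨h3, h4⟩
    rcases hcd.lt_or_gt with h | h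
    · exact hsep _ c d hc hd h (by linarith)
    · exact hsep _ d c hd hc h (by linarith)
  refine (countable_iUnion hcount).mono ?_
  rintro c ⟨ε, hε, h⟩
  obtain ⟨n, hn⟩ := exists_nat_one_div_lt hε
  exact mem_iUnion.2 ⟨n, hmono _ _ _ Nat.one_div_pos_of_nat hn.le h⟩

/-- If `c < d` are close, the ray of slope `1` from `⟨0, c⟩` meets the ray of slope `-1` from `⟨0,
d⟩`. There the height of `f` would exceed `c + ε` by continuity at `1_c`, yet be at most `d` by
continuity at `-1_d`. -/
theorem countable_setOf_lt_of_mem_lowerSide {f : ↥zeroPointsᶜ → PruferSurface}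
    (hf : Continuous f) : {c | c < (blowDown (f (nonzeroPoint c one_ne_zero))).2 ∧
      f (nonzeroPoint c (neg_ne_zero.2 one_ne_zero)) ∈ lowerSide c}.Countable := by
  refine (Set.countable_of_separated
    (P := fun ε c => ∀ x (hx : 0 < x), x < ε →
      c + ε < (blowDown (f (innerPoint x (1 * x + c) hx))).2 ∧
        f (innerPoint x (-1 * x + c) hx) ∈ lowerSide c) ?_ ?_).mono ?_
  · intro ε ε' c hε' hle h x hx hxε
    obtain ⟨h1, h2⟩ := h x hx (hxε.trans_le hle)
    exact ⟨by linarith, h2⟩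
  · intro ε c d hc hd hcd hdc
    -- This is the abscissa at which the two rays cross.
    have hx : 0 < (d - c) / 2 := by linarith
    have h1 := (hc _ hx (by linarith)).1
    have h2 := le_of_mem_lowerSide (hd _ hx (by linarith)).2
    rw [show -1 * ((d - c) / 2) + d = 1 * ((d - c) / 2) + c by ring] at h2
    linarith
  · rintro c ⟨h1, h2⟩
    -- An intermediate height `m` leaves room for the uniform gap: `c + ε ≤ m` once `ε ≤ m - c`.
    obtain ⟨m, hm, hm'⟩ := exists_between h1
    have hc : Continuous fun p => (blowDown (f p)).2 := (continuous_blowDown.comp hf).snd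
    obtain ⟨ε₁, hε₁, h₁⟩ := exists_innerPoint_mem
      (hc.continuousAt.eventually_mem (Ioi_mem_nhds hm'))
    obtain ⟨ε₂, hε₂, h₂⟩ := exists_innerPoint_mem
      (hf.continuousAt.eventually_mem ((isOpen_lowerSide c).mem_nhds h2))
    refine ⟨min (m - c) (min ε₁ ε₂), by simp [hε₁, hε₂, hm], fun x hx hxε => ?_⟩
    have k1 := h₁ x hx (hxε.trans_le ((min_le_right _ _).trans (min_le_left _ _)))
    have k2 := h₂ x hx (hxε.trans_le ((min_le_right _ _).trans (min_le_right _ _)))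
    refine ⟨lt_of_le_of_lt ?_ (mem_Ioi.1 k1), k2⟩
    linarith [min_le_left (m - c) (min ε₁ ε₂)]

/-- Mirror image of the preceding argument: at the crossing point the height would be below `d - ε`
and at least `c`. -/
theorem countable_setOf_lt_of_mem_upperSide {f : ↥zeroPointsᶜ → PruferSurface}
    (hf : Continuous f) : {c | (blowDown (f (nonzeroPoint c (neg_ne_zero.2 one_ne_zero)))).2 < c ∧
      f (nonzeroPoint c one_ne_zero) ∈ upperSide c}.Countable := by
  refine (Set.countable_of_separated
    (P := fun ε c => ∀ x (hx : 0 < x), x < ε →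
      (blowDown (f (innerPoint x (-1 * x + c) hx))).2 < c - ε ∧
        f (innerPoint x (1 * x + c) hx) ∈ upperSide c) ?_ ?_).mono ?_
  · intro ε ε' c hε' hle h x hx hxε
    obtain ⟨h1, h2⟩ := h x hx (hxε.trans_le hle)
    exact ⟨by linarith, h2⟩
  · intro ε c d hc hd hcd hdc
    have hx : 0 < (d - c) / 2 := by linarith
    have h1 := (hd _ hx (by linarith)).1
    have h2 := le_of_mem_upperSide (hc _ hx (by linarith)).2
    rw [show -1 * ((d - c) / 2) + d = 1 * ((d - c) / 2) + c by ring] at h1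
    linarith
  · rintro c ⟨h1, h2⟩
    obtain ⟨m, hm, hm'⟩ := exists_between h1
    have hc : Continuous fun p => (blowDown (f p)).2 := (continuous_blowDown.comp hf).snd
    obtain ⟨ε₁, hε₁, h₁⟩ := exists_innerPoint_mem
      (hc.continuousAt.eventually_mem (Iio_mem_nhds hm))
    obtain ⟨ε₂, hε₂, h₂⟩ := exists_innerPoint_mem
      (hf.continuousAt.eventually_mem ((isOpen_upperSide c).mem_nhds h2))
    refine ⟨min (c - m) (min ε₁ ε₂), by simp [hε₁, hε₂, hm'], fun x hx hxε => ?_⟩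
    have k1 := h₁ x hx (hxε.trans_le ((min_le_right _ _).trans (min_le_left _ _)))
    have k2 := h₂ x hx (hxε.trans_le ((min_le_right _ _).trans (min_le_right _ _)))
    refine ⟨(mem_Iio.1 k1).trans_le ?_, k2⟩
    linarith [min_le_left (c - m) (min ε₁ ε₂)]

/-- A map homotopic to the identity preserves all but countably many boundary components. -/
theorem countable_setOf_notMem_boundaryLine {k : C(↥zeroPointsᶜ, ↥zeroPointsᶜ)}
    (h : (ContinuousMap.id ↥zeroPointsᶜ).Homotopic k) :
    {c | (k (nonzeroPoint c one_ne_zero)).1 ∉ boundaryLine c}.Countable := by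
  obtain ⟨H⟩ := h
  obtain ⟨T, hT, hTd⟩ := TopologicalSpace.exists_countable_dense I
  have hHt : ∀ t : I, Continuous fun p : ↥zeroPointsᶜ => (H (t, p)).1 := fun t => by fun_prop
  have hHp : ∀ p : ↥zeroPointsᶜ, Continuous fun t : I => (H (t, p)).1 := fun p => by fun_prop
  -- The countable exceptional sets of the times in `T` are discarded together. For any other `c`,
  -- the times at which `1_c` is above and `-1_c` below form a clopen set.
  refine (hT.biUnion fun t _ => (countable_setOf_lt_of_mem_lowerSide (hHt t)).union
    (countable_setOf_lt_of_mem_upperSide (hHt t))).mono fun c hc => ?_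
  by_contra hcT
  let p : ↥zeroPointsᶜ := nonzeroPoint c one_ne_zero
  let q : ↥zeroPointsᶜ := nonzeroPoint c (neg_ne_zero.2 one_ne_zero)
  let O : Set I := {t | (H (t, p)).1 ∈ upperSide c} ∩ {t | (H (t, q)).1 ∈ lowerSide c}
  let C : Set I := {t | (H (t, p)).1 ∈ boundaryLine c} ∩ {t | (H (t, q)).1 ∈ boundaryLine c}
  have hO : IsOpen O := ((isOpen_upperSide c).preimage (hHp p)).inter
    ((isOpen_lowerSide c).preimage (hHp q))
  have hC : IsClosed C := ((isClosed_boundaryLine c).preimage (hHp p)).inter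
    ((isClosed_boundaryLine c).preimage (hHp q))
  -- At a time in `T`, being on the correct side without leaving the height `c` strictly forces both
  -- points to be on `ℝ_c`.
  have hOT : O ∩ T ⊆ C := by
    rintro t ⟨⟨h1, h2⟩, ht⟩
    refine ⟨mem_boundaryLine_of_mem_upperSide h1 ?_, mem_boundaryLine_of_mem_lowerSide h2 ?_⟩
    · by_contra! hlt
      exact hcT (mem_iUnion₂.2 ⟨t, ht, .inl ⟨hlt, h2⟩⟩)
    · by_contra! hlt
      exact hcT (mem_iUnion₂.2 ⟨t, ht, .inr ⟨hlt, h1⟩⟩)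
  have hOC : closure O ⊆ C := by
    refine closure_minimal ?_ hC
    exact (hTd.open_subset_closure_inter hO).trans (closure_minimal hOT hC)
  -- A limit of times in `O` keeps both points on `ℝ_c`; since `0_c` is missing and the sides are
  -- open and disjoint, neither point can have changed sides.
  have hclosed : IsClosed O := by
    refine isClosed_of_closure_subset fun t ht => ?_
    obtain ⟨h1, h2⟩ := hOC ht
    rw [mem_closure_iff] at ht
    constructor
    · refine (mem_sides_of_mem_boundaryLine h1 (H (t, p)).2).resolve_right fun h => ?_
      obtain ⟨s, hs, hs'⟩ := ht _ ((isOpen_lowerSide c).preimage (hHp p)) h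
      exact Set.disjoint_left.1 (disjoint_upperSide_lowerSide c) hs'.1 hs
    · refine (mem_sides_of_mem_boundaryLine h2 (H (t, q)).2).resolve_left fun h => ?_
      obtain ⟨s, hs, hs'⟩ := ht _ ((isOpen_upperSide c).preimage (hHp q)) h
      exact Set.disjoint_left.1 (disjoint_upperSide_lowerSide c) hs hs'.2
  have h0 : (0 : I) ∈ O := by
    constructor
    · simp [p, nonzeroPoint]
    · simp [q, nonzeroPoint]
  have huniv : O = univ := IsClopen.eq_univ ⟨hclosed, hO⟩ ⟨0, h0⟩
  have h1 : (1 : I) ∈ C := hOC (subset_closure (huniv ▸ mem_univ 1))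
  refine hc ?_
  have := h1.1
  rwa [mem_ofPred_eq, H.apply_one] at this

/-- For uncountably many `c` the map would send `1_c` into `ℝ_c`, whereas a Lindelöf set meets only
countably many of these lines. -/
theorem not_homotopic_id_of_isLindelof {k : C(↥zeroPointsᶜ, ↥zeroPointsᶜ)}
    {S : Set ↥zeroPointsᶜ} (hS : IsLindelof S) (hk : ∀ p, k p ∈ S) :
    ¬ (ContinuousMap.id ↥zeroPointsᶜ).Homotopic k := by
  intro h
  have h1 := countable_setOf_notMem_boundaryLine h
  have h2 := countable_setOf_boundary_mem (hS.image continuous_subtype_val)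
  refine Set.not_countable_univ ((h1.union h2).mono fun c _ => ?_)
  by_cases hc : (k (nonzeroPoint c one_ne_zero)).1 ∈ boundaryLine c
  · obtain ⟨u, hu⟩ := mem_boundaryLine.1 hc
    exact .inr ⟨u, hu ▸ mem_image_of_mem _ (hk _)⟩
  · exact .inl hc

theorem not_contractibleSpace_compl_zeroPoints : ¬ ContractibleSpace ↥zeroPointsᶜ := by
  intro _
  obtain ⟨p, hp⟩ := id_nullhomotopic ↥zeroPointsᶜ
  exact not_homotopic_id_of_isLindelof isLindelof_singleton (fun _ => mem_singleton p) hp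

end PruferSurface

/-! ### Countable subcomplexes and the comparison with CW complexes -/

namespace Topology.CWComplex

/-- Countably many points of a CW complex lie in a closed Lindelöf subset, namely in a countable
subcomplex. -/
theorem exists_isClosed_isLindelof_of_countable {K : Type*} [TopologicalSpace K] [T2Space K]
    [CWComplex (univ : Set K)] {T : Set K} (hT : T.Countable) :
    ∃ L : Set K, IsClosed L ∧ IsLindelof L ∧ T ⊆ L := by
  choose F hF using RelCWComplex.cellFrontier_subset_finite_openCell (C := (univ : Set K))
  have hcell : ∀ x : K, ∃ s : Σ n, RelCWComplex.cell (univ : Set K) n,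
      x ∈ RelCWComplex.openCell s.1 s.2 := fun x => by
    have hx : x ∈ (univ : Set K) := mem_univ x
    rw [← iUnion_openCell_eq_complex (C := (univ : Set K))] at hx
    obtain ⟨n, j, h⟩ := mem_iUnion₂.1 hx
    exact ⟨⟨n, j⟩, h⟩
  choose e he using hcell
  let faces (s : Σ n, RelCWComplex.cell (univ : Set K) n) :
      Set (Σ n, RelCWComplex.cell (univ : Set K) n) :=
    ⋃ m, Sigma.mk m '' (F s.1 s.2 m : Set (RelCWComplex.cell (univ : Set K) m))
  have hfaces : ∀ s, (faces s).Countable := fun s =>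
    countable_iUnion fun m => ((F s.1 s.2 m).countable_toSet).image _
  -- Starting from the cells containing points of `T`, the cells meeting the frontiers are added
  -- repeatedly; each frontier needs only finitely many, so the union stays countable and becomes a
  -- subcomplex.
  let J : ℕ → Set (Σ n, RelCWComplex.cell (univ : Set K) n) :=
    fun k => k.rec (e '' T) fun _ S => ⋃ s ∈ S, faces s
  have hJ : ∀ k, (J k).Countable := fun k => by
    induction k with
    | zero => exact hT.image e
    | succ k ih => exact ih.biUnion fun s _ => hfaces s
  let U := ⋃ k, J k
  have hU : U.Countable := countable_iUnion hJ
  let L : Set K := ⋃ (n : ℕ) (j : {j : RelCWComplex.cell (univ : Set K) n | ⟨n, j⟩ ∈ U}),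
    RelCWComplex.openCell n j.1
  have hmem : ∀ s ∈ U, RelCWComplex.openCell s.1 s.2 ⊆ L := fun s hs x hx =>
    mem_iUnion₂.2 ⟨s.1, ⟨s.2, hs⟩, hx⟩
  have hclosedCell : ∀ s ∈ U, RelCWComplex.closedCell s.1 s.2 ⊆ L := by
    intro s hs
    rw [← RelCWComplex.cellFrontier_union_openCell_eq_closedCell]
    refine union_subset ((hF s.1 s.2).trans ?_) (hmem s hs)
    simp only [empty_union, iUnion_subset_iff]
    intro m _ j hj
    refine hmem ⟨m, j⟩ ?_
    obtain ⟨k, hk⟩ := mem_iUnion.1 hs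
    exact mem_iUnion.2 ⟨k + 1, mem_iUnion₂.2 ⟨s, hk, mem_iUnion.2 ⟨m, j, hj, rfl⟩⟩⟩
  have hL : L = ⋃ s ∈ U, RelCWComplex.closedCell s.1 s.2 := by
    refine Subset.antisymm (fun x hx => ?_) (iUnion₂_subset hclosedCell)
    obtain ⟨n, j, h⟩ := mem_iUnion₂.1 hx
    exact mem_iUnion₂.2 ⟨⟨n, j.1⟩, j.2, RelCWComplex.openCell_subset_closedCell _ _ h⟩
  refine ⟨L, ?_, ?_, fun x hx => ?_⟩
  · exact (CWComplex.Subcomplex.mk' (univ : Set K) L _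
      (fun n i => hclosedCell ⟨n, i.1⟩ i.2) rfl).closed
  · rw [hL]
    have := hU.to_subtype
    rw [biUnion_eq_iUnion]
    exact isLindelof_iUnion fun s => RelCWComplex.isCompact_closedCell.isLindelof
  · exact hmem (e x) (mem_iUnion.2 ⟨0, mem_image_of_mem e hx⟩) (he x)

/-- The image of a countable dense set lies in a closed Lindelöf set, which then contains the whole
image. -/
theorem exists_isLindelof_range_subset {K X : Type*} [TopologicalSpace K] [T2Space K]
    [CWComplex (univ : Set K)] [TopologicalSpace X] [TopologicalSpace.SeparableSpace X]
    {f : X → K} (hf : Continuous f) : ∃ L : Set K, IsLindelof L ∧ range f ⊆ L := by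
  obtain ⟨D, hD, hDd⟩ := TopologicalSpace.exists_countable_dense X
  obtain ⟨L, hL, hL', hDL⟩ := exists_isClosed_isLindelof_of_countable (hD.image f)
  exact ⟨L, hL', (hf.range_subset_closure_image_dense hDd).trans (closure_minimal hDL hL)⟩

end Topology.CWComplex

theorem PruferSurface.isEmpty_homotopyEquiv_cwComplex (K : Type*) [TopologicalSpace K] [T2Space K]
    [Topology.CWComplex (Set.univ : Set K)] :
    IsEmpty (ContinuousMap.HomotopyEquiv ↥(PruferSurface.zeroPointsᶜ) K) := by
  refine ⟨fun e => ?_⟩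
  obtain ⟨L, hL, hrange⟩ := CWComplex.exists_isLindelof_range_subset e.toFun.continuous
  -- The composite through `K` takes values in the continuous image of a Lindelöf set, yet it is
  -- homotopic to the identity.
  exact not_homotopic_id_of_isLindelof (hL.image e.invFun.continuous)
    (fun p => mem_image_of_mem _ (hrange (mem_range_self p))) e.left_inv.symm

theorem theorem1p7 :
    -- the Prüfer surface is a separable contractible surface with boundary
    (IsSurfaceWithBoundary PruferSurface ∧
      TopologicalSpace.SeparableSpace PruferSurface ∧
      ContractibleSpace PruferSurface) ∧
    -- the complement of the `0`-points is an open, separable, non-metrizable subsurface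
    IsClosed PruferSurface.zeroPoints ∧
    IsSurfaceWithBoundary ↥(PruferSurface.zeroPointsᶜ) ∧
    TopologicalSpace.SeparableSpace ↥(PruferSurface.zeroPointsᶜ) ∧
    ¬ TopologicalSpace.MetrizableSpace ↥(PruferSurface.zeroPointsᶜ) ∧
    -- it has trivial homotopy groups (and is path connected, the case `n = 0`)
    (∀ (n : ℕ) (x : ↥(PruferSurface.zeroPointsᶜ)),
      Subsingleton (HomotopyGroup.Pi n ↥(PruferSurface.zeroPointsᶜ) x)) ∧
    -- it is not contractible
    ¬ ContractibleSpace ↥(PruferSurface.zeroPointsᶜ) ∧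
    -- it is not homotopy equivalent to a CW complex
    (∀ (K : Type*) [TopologicalSpace K] [T2Space K] [Topology.CWComplex (Set.univ : Set K)],
      IsEmpty (ContinuousMap.HomotopyEquiv ↥(PruferSurface.zeroPointsᶜ) K)) :=
  ⟨⟨PruferSurface.isSurfaceWithBoundary, inferInstance, inferInstance⟩,
    PruferSurface.isClosed_zeroPoints, PruferSurface.isSurfaceWithBoundary_compl_zeroPoints,
    inferInstance, PruferSurface.not_metrizableSpace_compl_zeroPoints,
    fun _ x => PruferSurface.subsingleton_homotopyGroup x,
    PruferSurface.not_contractibleSpace_compl_zeroPoints,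
    PruferSurface.isEmpty_homotopyEquiv_cwComplex⟩
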